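/- Consider a receiver with $N$ equally spaced ports on a line segment of length $W\lambda$ ($W>0$, $\lambda>0$ the wavelength), and let $\kappa\ge 0$ be the Rician factor, $A=\sqrt{\kappa/(\kappa+1)}$, $\sigma=\sqrt{1/(\kappa+1)}$. Put $l_{n}=\frac{n-1}{N-1}W\lambda$ and $\rho_n=J_0(2\pi l_{n}/\lambda)$ for $2\le n\le N$, where $J_0$ is the Bessel function of the first kind of order $0$. Let $x_0,y_0,x_2,y_2,x_3,y_3,\dots$ be independent real $\mathcal N(0,\tfrac12)$ random variables and let the channel coefficients be $$h_1=\sigma x_0+j\sigma y_0+A,\qquad h_n=\sigma\Big(\sqrt{1-\rho_n^2}\,x_n+\rho_n x_0\Big)+j\sigma\Big(\sqrt{1-\rho_n^2}\,y_n+\rho_n y_0\Big)+A\quad(2\le n\le N).$$ For a threshold $\gamma_{th}>0$ the outage probability is $$p_{out}(N)=\mathbb P\left(\frac{\max_{1\le n\le N}|h_n|^2}{A^2+\sigma^2}<\gamma_{th}\right).$$ **Proposition.** Fix $W>0$, $\lambda>0$, $\kappa\ge0$ and $\gamma_{th}>0$. Then $|\rho_n|\ne 1$ for all $2\le n\le N$,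 $p_{out}(N)>0$ for all $N\ge1$, and the high-$N$ slope is infinite: $$S_\infty=-\lim_{N\to\infty}\frac{\log p_{out}(N)}{\log N}=+\infty .$$ Consequently the outage probability can be made arbitrarily small by increasing the number of ports: for every $\varepsilon>0$ there is $N_0$ such that $p_{out}(N)<\varepsilon$ for all $N\ge N_0$. -/

import Mathlib

open MeasureTheory ProbabilityTheory Filter Topology
open scoped NNReal

noncomputable section

/-- The Bessel function of the first kind of order zero, by Bessel's integral
`J₀(x) = (1/π) ∫₀^π cos(x sin θ) dθ`. -/
def besselJ0 (x : ℝ) : ℝ :=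
  (1 / Real.pi) * ∫ θ in (0 : ℝ)..Real.pi, Real.cos (x * Real.sin θ)

/-- Displacement from port 1 of the `n`-th of `N` equally spaced ports on a line of length `W * lam`,
where `lam` is the carrier wavelength. -/
def portDisplacement (W lam : ℝ) (N n : ℕ) : ℝ :=
  (((n : ℝ) - 1) / ((N : ℝ) - 1)) * (W * lam)

/-- Spatial correlation factor `ρ_n` between port 1 and port `n` (of `N` ports). -/
def portCorrelation (W lam : ℝ) (N n : ℕ) : ℝ :=
  besselJ0 (2 * Real.pi * (portDisplacement W lam N n / lam))

/-- Amplitude `A` of the line-of-sight component for Rician factor `κ`: `A² = κ / (κ + 1)`. -/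
def losAmplitude (κ : ℝ) : ℝ := Real.sqrt (κ / (κ + 1))

/-- Scale `σ` of the scattered component for Rician factor `κ`: `σ² = 1 / (κ + 1)`. -/
def scatterScale (κ : ℝ) : ℝ := Real.sqrt (1 / (κ + 1))

/-- The complex channel coefficient `h_n`, `1 ≤ n ≤ N`, of the Rician fluid antenna with `N` ports,
driven by the real random variables `x_0, x_n, y_0, y_n`. -/
def channel {Ω : Type*} (x y : ℕ → Ω → ℝ) (W lam κ : ℝ) (N n : ℕ) (ω : Ω) : ℂ :=
  let σ := scatterScale κ
  let A := losAmplitude κ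
  let ρ := portCorrelation W lam N n
  if n = 1 then
    ((σ * x 0 ω : ℝ) : ℂ) + Complex.I * ((σ * y 0 ω : ℝ) : ℂ) + (A : ℂ)
  else
    ((σ * (Real.sqrt (1 - ρ ^ 2) * x n ω + ρ * x 0 ω) : ℝ) : ℂ)
      + Complex.I * ((σ * (Real.sqrt (1 - ρ ^ 2) * y n ω + ρ * y 0 ω) : ℝ) : ℂ) + (A : ℂ)

/-- The gain `|h_FAS| = max {|h_1|, …, |h_N|}` of the strongest port. -/
def fasGain {Ω : Type*} (x y : ℕ → Ω → ℝ) (W lam κ : ℝ) (N : ℕ) (ω : Ω) : ℝ :=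
  ((Finset.Icc 1 N).sup fun n => ‖channel x y W lam κ N n ω‖₊ : ℝ≥0)

/-- The outage probability: the probability that the normalized signal-to-noise ratio
`|h_FAS|² / (A² + σ²)` is below the threshold `γ`. -/
def outageProb {Ω : Type*} [MeasurableSpace Ω] (P : Measure Ω) (x y : ℕ → Ω → ℝ)
    (W lam κ γ : ℝ) (N : ℕ) : ℝ :=
  P.real {ω | fasGain x y W lam κ N ω ^ 2 / (losAmplitude κ ^ 2 + scatterScale κ ^ 2) < γ}

end

/-!
Only the far half of the ports matters. Since `|J₀| < 1` away from the origin, compactness keeps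
`√(1 - ρ_n²)` above some `s₀ > 0` for every port in that half, uniformly in `N`. Conditionally on
`x₀`, the real part of `h_n` is then an affine image of `x_n` with slope at least `σ s₀`, so it stays
in a bounded window with probability at most some `c < 1` depending neither on `n` nor on `x₀`. As
the `x_n` are independent, the outage probability is at most `c ^ (N / 2)`, which decays faster than
any power of `N`. It never vanishes: outage is an open event in the driving variables, whose laws
have full support, and some configuration makes all the channels zero.
-/

lemma continuous_besselJ0 : Continuous besselJ0 := by
  unfold besselJ0
  fun_prop

lemma exists_abs_cos_mul_sin_lt_one {x : ℝ} (hx : x ≠ 0) :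
    ∃ θ ∈ Set.Icc 0 Real.pi, |Real.cos (x * Real.sin θ)| < 1 := by
  have hx' : 0 < |x| := abs_pos.2 hx
  obtain ⟨s, hs, hs_le⟩ : ∃ s : ℝ, 0 < s ∧ s ≤ min 1 |x|⁻¹ := ⟨_, by positivity, le_rfl⟩
  have hs_one : s ≤ 1 := hs_le.trans (min_le_left _ _)
  have hxs : |x| * s ≤ 1 := (le_inv_mul_iff₀ hx').1 (by simpa using hs_le.trans (min_le_right _ _))
  refine ⟨Real.arcsin s, ⟨Real.arcsin_nonneg.2 hs.le,
    (Real.arcsin_le_pi_div_two s).trans (by linarith [Real.pi_pos])⟩, ?_⟩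
  have hsin : 0 < Real.sin (|x| * s) :=
    Real.sin_pos_of_pos_of_lt_pi (by positivity) (by linarith [Real.pi_gt_three])
  rw [Real.sin_arcsin (by linarith) hs_one, ← sq_lt_one_iff_abs_lt_one, ← Real.cos_abs, abs_mul,
    abs_of_pos hs, Real.cos_sq']
  linarith [pow_pos hsin 2]

lemma abs_besselJ0_lt_one {x : ℝ} (hx : x ≠ 0) : |besselJ0 x| < 1 := by
  have hlt : ∫ θ in (0 : ℝ)..Real.pi, |Real.cos (x * Real.sin θ)| < ∫ _ in (0 : ℝ)..Real.pi, 1 :=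
    intervalIntegral.integral_lt_integral_of_continuousOn_of_le_of_exists_lt Real.pi_pos
      (by fun_prop) (by fun_prop) (fun θ _ => Real.abs_cos_le_one _)
      (exists_abs_cos_mul_sin_lt_one hx)
  rw [besselJ0, abs_mul, abs_of_pos (by positivity), one_div, inv_mul_lt_iff₀ Real.pi_pos]
  calc |∫ θ in (0 : ℝ)..Real.pi, Real.cos (x * Real.sin θ)|
      ≤ ∫ θ in (0 : ℝ)..Real.pi, |Real.cos (x * Real.sin θ)| :=
        intervalIntegral.abs_integral_le_integral_abs Real.pi_pos.le
    _ < ∫ _ in (0 : ℝ)..Real.pi, 1 := hlt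
    _ = Real.pi * 1 := by simp

lemma sqrt_one_sub_besselJ0_sq_pos {x : ℝ} (hx : x ≠ 0) : 0 < √(1 - besselJ0 x ^ 2) :=
  Real.sqrt_pos.2 (sub_pos.2 ((sq_lt_one_iff_abs_lt_one _).2 (abs_besselJ0_lt_one hx)))

section PortCorrelation

variable {W lam : ℝ}

lemma portCorrelation_eq_besselJ0 (hlam : lam ≠ 0) (N n : ℕ) :
    portCorrelation W lam N n =
      besselJ0 (2 * Real.pi * (((n : ℝ) - 1) / ((N : ℝ) - 1) * W)) := by
  rw [portCorrelation, portDisplacement, ← mul_assoc, mul_div_cancel_right₀ _ hlam]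

lemma abs_portCorrelation_lt_one (hW : W ≠ 0) (hlam : lam ≠ 0) {N n : ℕ} (hn : 2 ≤ n)
    (hnN : n ≤ N) : |portCorrelation W lam N n| < 1 := by
  have hn' : (n : ℝ) - 1 ≠ 0 := sub_ne_zero.2 (by exact_mod_cast (by lia : n ≠ 1))
  have hN' : (N : ℝ) - 1 ≠ 0 := sub_ne_zero.2 (by exact_mod_cast (by lia : N ≠ 1))
  rw [portCorrelation_eq_besselJ0 hlam]
  exact abs_besselJ0_lt_one (by positivity)

lemma exists_pos_le_sqrt_one_sub_portCorrelation_sq (hW : W ≠ 0) (hlam : lam ≠ 0) :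
    ∃ s₀ : ℝ, 0 < s₀ ∧ ∀ N n : ℕ, 2 ≤ n → n ≤ N → N < 2 * n →
      s₀ ≤ √(1 - portCorrelation W lam N n ^ 2) := by
  have hcont : Continuous fun t : ℝ => √(1 - besselJ0 (2 * Real.pi * (t * W)) ^ 2) := by
    have := continuous_besselJ0
    fun_prop
  have hpos : ∀ t ∈ Set.Icc (1 / 2 : ℝ) 1, 0 < √(1 - besselJ0 (2 * Real.pi * (t * W)) ^ 2) := by
    intro t ht
    have ht_ne : t ≠ 0 := (one_half_pos.trans_le ht.1).ne'
    exact sqrt_one_sub_besselJ0_sq_pos (by positivity)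
  obtain ⟨s₀, hs₀, hle⟩ := isCompact_Icc.exists_forall_le' hcont.continuousOn hpos
  refine ⟨s₀, hs₀, fun N n hn hnN hNn => ?_⟩
  have hn' : (2 : ℝ) ≤ n := by exact_mod_cast hn
  have hnN' : (n : ℝ) ≤ N := by exact_mod_cast hnN
  have hNn' : (N : ℝ) + 1 ≤ 2 * n := by exact_mod_cast hNn
  rw [portCorrelation_eq_besselJ0 hlam]
  refine hle _ ⟨?_, (div_le_one (by linarith)).2 (by linarith)⟩
  rw [div_le_div_iff₀ two_pos (by linarith)]
  linarith

end PortCorrelation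

lemma scatterScale_pos {κ : ℝ} (hκ : 0 ≤ κ) : 0 < scatterScale κ :=
  Real.sqrt_pos.2 (by positivity)

lemma losAmplitude_sq_add_scatterScale_sq {κ : ℝ} (hκ : 0 ≤ κ) :
    losAmplitude κ ^ 2 + scatterScale κ ^ 2 = 1 := by
  rw [losAmplitude, scatterScale, Real.sq_sqrt (by positivity), Real.sq_sqrt (by positivity)]
  field_simp

section Channel

variable {Ω : Type*} {x y : ℕ → Ω → ℝ} {W lam κ γ : ℝ} {N n : ℕ} {ω : Ω}

lemma channel_one_eq_zero (hσ : scatterScale κ ≠ 0)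
    (hx : x 0 ω = -(losAmplitude κ / scatterScale κ)) (hy : y 0 ω = 0) :
    channel x y W lam κ N 1 ω = 0 := by
  have hre : scatterScale κ * x 0 ω + losAmplitude κ = 0 := by
    rw [hx]
    field_simp
    ring
  apply Complex.ext
  · simpa [channel] using hre
  · simp [channel, hy]

lemma channel_re (hn : n ≠ 1) :
    (channel x y W lam κ N n ω).re =
      scatterScale κ * √(1 - portCorrelation W lam N n ^ 2) * x n ω +
        (scatterScale κ * portCorrelation W lam N n * x 0 ω + losAmplitude κ) := by
  simp only [channel, hn, if_false, Complex.add_re, Complex.ofReal_re, Complex.re_mul_ofReal,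
    Complex.I_re, zero_mul, add_zero]
  ring

lemma channel_im (hn : n ≠ 1) :
    (channel x y W lam κ N n ω).im =
      scatterScale κ * √(1 - portCorrelation W lam N n ^ 2) * y n ω +
        scatterScale κ * portCorrelation W lam N n * y 0 ω := by
  simp only [channel, hn, if_false, Complex.add_im, Complex.ofReal_im, Complex.im_mul_ofReal,
    Complex.I_im, one_mul, zero_add, add_zero]
  ring

lemma channel_eq_zero (hn : n ≠ 1) (hσ : scatterScale κ ≠ 0)
    (hρ : √(1 - portCorrelation W lam N n ^ 2) ≠ 0)
    (hx₀ : x 0 ω = -(losAmplitude κ / scatterScale κ))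
    (hxn : x n ω = -(losAmplitude κ / scatterScale κ * (1 - portCorrelation W lam N n)) /
      √(1 - portCorrelation W lam N n ^ 2))
    (hy₀ : y 0 ω = 0) (hyn : y n ω = 0) :
    channel x y W lam κ N n ω = 0 := by
  apply Complex.ext
  · rw [channel_re hn, hx₀, hxn, Complex.zero_re]
    field_simp
    ring
  · simp [channel_im hn, hy₀, hyn]

lemma norm_channel_le_fasGain (hn : n ∈ Finset.Icc 1 N) :
    ‖channel x y W lam κ N n ω‖ ≤ fasGain x y W lam κ N ω :=
  NNReal.coe_le_coe.2 (Finset.le_sup (f := fun n => ‖channel x y W lam κ N n ω‖₊) hn)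

lemma fasGain_lt_sqrt_of_outage (hκ : 0 ≤ κ)
    (h : fasGain x y W lam κ N ω ^ 2 / (losAmplitude κ ^ 2 + scatterScale κ ^ 2) < γ) :
    fasGain x y W lam κ N ω < √γ := by
  rw [losAmplitude_sq_add_scatterScale_sq hκ, div_one] at h
  exact Real.lt_sqrt_of_sq_lt h

lemma fasGain_eq_zero (h : ∀ n ∈ Finset.Icc 1 N, channel x y W lam κ N n ω = 0) :
    fasGain x y W lam κ N ω = 0 := by
  rw [fasGain, NNReal.coe_eq_zero, ← bot_eq_zero, Finset.sup_eq_bot_iff]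
  intro n hn
  simp [h n hn]

lemma continuous_channel [TopologicalSpace Ω] (hx : ∀ n, Continuous (x n))
    (hy : ∀ n, Continuous (y n)) : Continuous (channel x y W lam κ N n) := by
  unfold channel
  split_ifs <;> fun_prop

lemma continuous_fasGain [TopologicalSpace Ω] (hx : ∀ n, Continuous (x n))
    (hy : ∀ n, Continuous (y n)) : Continuous (fasGain x y W lam κ N) :=
  NNReal.continuous_coe.comp
    (Continuous.finset_sup_apply fun _ _ => (continuous_channel hx hy).nnnorm)

lemma exists_fasGain_eq_zero (hW : W ≠ 0) (hlam : lam ≠ 0) (hκ : 0 ≤ κ) (N : ℕ) :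
    ∃ z : ℕ ⊕ ℕ → ℝ,
      fasGain (fun n z => z (Sum.inl n)) (fun n z => z (Sum.inr n)) W lam κ N z = 0 := by
  have hσ := (scatterScale_pos hκ).ne'
  let u : ℕ → ℝ := fun n => if n = 0 then -(losAmplitude κ / scatterScale κ) else
    -(losAmplitude κ / scatterScale κ * (1 - portCorrelation W lam N n)) /
      √(1 - portCorrelation W lam N n ^ 2)
  refine ⟨Sum.elim u 0, fasGain_eq_zero fun n hn => ?_⟩
  obtain ⟨hn_pos, hnN⟩ := Finset.mem_Icc.1 hn
  rcases eq_or_ne n 1 with rfl | hn_one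
  · exact channel_one_eq_zero hσ rfl rfl
  · have hρ := abs_portCorrelation_lt_one hW hlam (by lia) hnN
    exact channel_eq_zero hn_one hσ
      (Real.sqrt_pos.2 (sub_pos.2 ((sq_lt_one_iff_abs_lt_one _).2 hρ))).ne' rfl
      (if_neg (by lia)) rfl rfl

end Channel

lemma isOpenPosMeasure_gaussianReal (m : ℝ) {v : ℝ≥0} (hv : v ≠ 0) :
    (gaussianReal m v).IsOpenPosMeasure :=
  (gaussianReal_absolutelyContinuous' m hv).isOpenPosMeasure

lemma measure_lt_one_of_nonempty_interior_compl {α : Type*} [TopologicalSpace α]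
    [MeasurableSpace α] {μ : Measure α} [IsProbabilityMeasure μ] [μ.IsOpenPosMeasure] {s : Set α}
    (hs : MeasurableSet s) (hne : (interior sᶜ).Nonempty) : μ s < 1 :=
  prob_le_one.lt_of_ne fun h =>
    (Measure.measure_pos_of_nonempty_interior μ hne).ne' ((prob_compl_eq_zero_iff hs).2 h)

lemma lt_div_of_abs_mul_add_lt {s₀ s m r z : ℝ} (hs₀ : 0 < s₀) (hs : s₀ ≤ s) (hm : 0 ≤ m)
    (hr : 0 ≤ r) (hz : |s * z + m| < r) : z < r / s₀ := by
  have hsz : s * z < r := by linarith [(abs_lt.1 hz).2]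
  calc z < r / s := (lt_div_iff₀' (hs₀.trans_le hs)).2 hsz
    _ ≤ r / s₀ := div_le_div_of_nonneg_left hr hs₀ hs

lemma neg_div_lt_of_abs_mul_add_lt {s₀ s m r z : ℝ} (hs₀ : 0 < s₀) (hs : s₀ ≤ s) (hm : m ≤ 0)
    (hr : 0 ≤ r) (hz : |s * z + m| < r) : -(r / s₀) < z := by
  have hz_neg : |s * -z + -m| < r := by rwa [mul_neg, ← neg_add, abs_neg]
  exact neg_lt.1 (lt_div_of_abs_mul_add_lt hs₀ hs (neg_nonneg.2 hm) hr hz_neg)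

lemma exists_measure_abs_mul_add_lt_le (μ : Measure ℝ) [IsProbabilityMeasure μ]
    [μ.IsOpenPosMeasure] {s₀ : ℝ} (hs₀ : 0 < s₀) {r : ℝ} (hr : 0 ≤ r) :
    ∃ c : ENNReal, 0 < c ∧ c < 1 ∧ ∀ s, s₀ ≤ s → ∀ m, μ {z | |s * z + m| < r} ≤ c := by
  refine ⟨max (μ (Set.Iio (r / s₀))) (μ (Set.Ioi (-(r / s₀)))),
    lt_max_of_lt_left (isOpen_Iio.measure_pos μ Set.nonempty_Iio),
    max_lt (measure_lt_one_of_nonempty_interior_compl measurableSet_Iio (by simp))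
      (measure_lt_one_of_nonempty_interior_compl measurableSet_Ioi (by simp)),
    fun s hs m => ?_⟩
  rcases le_total 0 m with hm | hm
  · exact le_max_of_le_left (measure_mono fun _ => lt_div_of_abs_mul_add_lt hs₀ hs hm hr)
  · exact le_max_of_le_right (measure_mono fun _ => neg_div_lt_of_abs_mul_add_lt hs₀ hs hm hr)

section Independence

variable {Ω : Type*} [MeasurableSpace Ω] {P : Measure Ω}

lemma measure_prodMk_mem_le_of_indepFun {α β : Type*} [MeasurableSpace α] [MeasurableSpace β]
    [IsProbabilityMeasure P] {X : Ω → α} {Y : Ω → β} (hX : AEMeasurable X P)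
    (hY : AEMeasurable Y P) (hindep : IndepFun X Y P) {E : Set (α × β)} (hE : MeasurableSet E)
    {c : ENNReal} (hc : ∀ a, P.map Y (Prod.mk a ⁻¹' E) ≤ c) : P {ω | (X ω, Y ω) ∈ E} ≤ c := by
  have : IsProbabilityMeasure (P.map X) := Measure.isProbabilityMeasure_map hX
  calc P {ω | (X ω, Y ω) ∈ E} = P.map (fun ω => (X ω, Y ω)) E :=
        (Measure.map_apply_of_aemeasurable (hX.prodMk hY) hE).symm
    _ = ∫⁻ a, P.map Y (Prod.mk a ⁻¹' E) ∂P.map X := by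
        rw [hindep.map_prod_eq_prod_map_map hX hY, Measure.prod_apply hE]
    _ ≤ ∫⁻ _, c ∂P.map X := lintegral_mono hc
    _ = c := by simp

variable {ι : Type*} {α : ι → Type*} [∀ i, MeasurableSpace (α i)] {X : ∀ i, Ω → α i}

lemma measure_forall_mem_le_pow_card_of_iIndepFun (hX : ∀ i, AEMeasurable (X i) P)
    (hindep : iIndepFun X P) {S : Finset ι} {B : ∀ i, Set (α i)}
    (hB : ∀ i ∈ S, MeasurableSet (B i)) {c : ENNReal} (hc : ∀ i ∈ S, P.map (X i) (B i) ≤ c) :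
    P {ω | ∀ i ∈ S, X i ω ∈ B i} ≤ c ^ S.card := by
  have hset : {ω | ∀ i ∈ S, X i ω ∈ B i} = ⋂ i ∈ S, X i ⁻¹' B i := by
    ext ω
    simp
  rw [hset, hindep.measure_inter_preimage_eq_mul S hB]
  refine Finset.prod_le_pow_card _ _ _ fun i hi => ?_
  rw [← Measure.map_apply_of_aemeasurable (hX i) (hB i hi)]
  exact hc i hi

lemma measure_forall_prodMk_mem_le_pow_card_of_iIndepFun (hX : ∀ i, AEMeasurable (X i) P)
    (hindep : iIndepFun X P) {i₀ : ι} {S : Finset ι} (hS : i₀ ∉ S) {B : ∀ i, Set (α i₀ × α i)}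
    (hB : ∀ i, MeasurableSet (B i)) {c : ENNReal}
    (hc : ∀ i ∈ S, ∀ a, P.map (X i) (Prod.mk a ⁻¹' B i) ≤ c) :
    P {ω | ∀ i ∈ S, (X i₀ ω, X i ω) ∈ B i} ≤ c ^ S.card := by
  have := hindep.isProbabilityMeasure
  let Z : Ω → ∀ i : S, α i := fun ω i => X i ω
  have hZ : AEMeasurable Z P := aemeasurable_pi_lambda _ fun i => hX i
  have hproj : Measurable fun v : ∀ i : ({i₀} : Finset ι), α i =>
      v ⟨i₀, Finset.mem_singleton_self i₀⟩ :=
    measurable_pi_apply _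
  have hindepZ : IndepFun (X i₀) Z P :=
    (hindep.indepFun_finset₀ {i₀} S (Finset.disjoint_singleton_left.2 hS) hX).comp
      hproj measurable_id
  let E : Set (α i₀ × ∀ i : S, α i) := {p | ∀ i : S, (p.1, p.2 i) ∈ B i}
  have hE : MeasurableSet E := by
    simp only [E, Set.ofPred_forall]
    exact MeasurableSet.iInter fun i => (by fun_prop : Measurable fun p : α i₀ × (∀ i : S, α i) =>
      (p.1, p.2 i)) (hB i)
  have hsection : ∀ a, P.map Z (Prod.mk a ⁻¹' E) ≤ c ^ S.card := by
    intro a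
    rw [Measure.map_apply_of_aemeasurable hZ (measurable_prodMk_left hE)]
    simpa [Z, E] using measure_forall_mem_le_pow_card_of_iIndepFun hX hindep
      (fun i _ => measurable_prodMk_left (hB i)) fun i hi => hc i hi a
  simpa [Z, E] using measure_prodMk_mem_le_of_indepFun (hX i₀) hZ hindepZ hE hsection

lemma measure_preimage_pos_of_iIndepFun [∀ i, TopologicalSpace (α i)]
    [∀ i, OpensMeasurableSpace (α i)] (hX : ∀ i, AEMeasurable (X i) P) (hindep : iIndepFun X P)
    (hpos : ∀ i, (P.map (X i)).IsOpenPosMeasure) {U : Set (∀ i, α i)} (hU : IsOpen U)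
    (hne : U.Nonempty) : 0 < P {ω | (fun i => X i ω) ∈ U} := by
  obtain ⟨a, ha⟩ := hne
  obtain ⟨S, V, hV, hVU⟩ := isOpen_pi_iff.1 hU a ha
  have hbox : 0 < P (⋂ i ∈ S, X i ⁻¹' V i) := by
    rw [hindep.measure_inter_preimage_eq_mul S fun i hi => (hV i hi).1.measurableSet]
    refine pos_of_ne_zero (Finset.prod_ne_zero_iff.2 fun i hi => ?_)
    rw [← Measure.map_apply_of_aemeasurable (hX i) (hV i hi).1.measurableSet]
    exact (hV i hi).1.measure_ne_zero _ ⟨a i, (hV i hi).2⟩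
  refine hbox.trans_le (measure_mono fun ω hω => hVU ?_)
  simpa [Set.mem_pi] using hω

lemma exists_measure_forall_abs_mul_add_lt_le_pow_card {ι : Type*} {X : ι → Ω → ℝ} {μ : Measure ℝ}
    [μ.IsOpenPosMeasure] (hX : ∀ i, HasLaw (X i) μ P) (hindep : iIndepFun X P) (i₀ : ι) {s₀ : ℝ}
    (hs₀ : 0 < s₀) {r : ℝ} (hr : 0 ≤ r) :
    ∃ c : ENNReal, 0 < c ∧ c < 1 ∧ ∀ S : Finset ι, i₀ ∉ S → ∀ (s : ι → ℝ) (f : ι → ℝ → ℝ),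
      (∀ i ∈ S, s₀ ≤ s i) → (∀ i, Measurable (f i)) →
        P {ω | ∀ i ∈ S, |s i * X i ω + f i (X i₀ ω)| < r} ≤ c ^ S.card := by
  have := hindep.isProbabilityMeasure
  have : IsProbabilityMeasure μ := (hX i₀).isProbabilityMeasure_iff.1 inferInstance
  obtain ⟨c, hc_pos, hc_lt, hc⟩ := exists_measure_abs_mul_add_lt_le μ hs₀ hr
  refine ⟨c, hc_pos, hc_lt, fun S hS s f hs hf => ?_⟩
  refine measure_forall_prodMk_mem_le_pow_card_of_iIndepFun (fun i => (hX i).aemeasurable) hindep hS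
    (B := fun i => {p | |s i * p.2 + f i p.1| < r})
    (fun i => measurableSet_lt (by fun_prop) measurable_const) fun i hi a => ?_
  rw [(hX i).map_eq]
  exact hc (s i) (hs i hi) (f i a)

end Independence

section Outage

variable {Ω : Type*} [MeasurableSpace Ω] {P : Measure Ω} {x y : ℕ → Ω → ℝ} {W lam κ γ : ℝ}

lemma outageProb_pos (hx : ∀ n, AEMeasurable (x n) P) (hy : ∀ n, AEMeasurable (y n) P)
    (hx_pos : ∀ n, (P.map (x n)).IsOpenPosMeasure) (hy_pos : ∀ n, (P.map (y n)).IsOpenPosMeasure)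
    (hindep : iIndepFun (Sum.elim x y) P) (hW : W ≠ 0) (hlam : lam ≠ 0) (hκ : 0 ≤ κ) (hγ : 0 < γ)
    (N : ℕ) : 0 < outageProb P x y W lam κ γ N := by
  have := hindep.isProbabilityMeasure
  let gain : (ℕ ⊕ ℕ → ℝ) → ℝ :=
    fasGain (fun n z => z (Sum.inl n)) (fun n z => z (Sum.inr n)) W lam κ N
  have hgain : Continuous gain := continuous_fasGain (by fun_prop) (by fun_prop)
  obtain ⟨z, hz⟩ : ∃ z, gain z = 0 := exists_fasGain_eq_zero hW hlam hκ N
  exact ENNReal.toReal_pos (measure_preimage_pos_of_iIndepFun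
    (U := {z | gain z ^ 2 / (losAmplitude κ ^ 2 + scatterScale κ ^ 2) < γ})
    (Sum.rec hx hy) hindep (Sum.rec hx_pos hy_pos) (isOpen_lt (by fun_prop) continuous_const)
    ⟨z, by simpa [hz] using hγ⟩).ne' (measure_ne_top _ _)

lemma exists_outageProb_le_pow {μ : Measure ℝ} [μ.IsOpenPosMeasure] (hx : ∀ n, HasLaw (x n) μ P)
    (hindep : iIndepFun x P) (y : ℕ → Ω → ℝ) (hW : W ≠ 0) (hlam : lam ≠ 0) (hκ : 0 ≤ κ) (γ : ℝ) :
    ∃ c : ℝ, 0 < c ∧ c < 1 ∧ ∀ N, 2 ≤ N → outageProb P x y W lam κ γ N ≤ c ^ (N - N / 2) := by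
  have hσ := scatterScale_pos hκ
  obtain ⟨s₀, hs₀, hs₀_le⟩ := exists_pos_le_sqrt_one_sub_portCorrelation_sq hW hlam
  obtain ⟨c, hc_pos, hc_lt, hc⟩ := exists_measure_forall_abs_mul_add_lt_le_pow_card hx hindep 0
    (mul_pos hσ hs₀) (Real.sqrt_nonneg γ)
  refine ⟨c.toReal, ENNReal.toReal_pos hc_pos.ne' hc_lt.ne_top,
    ENNReal.toReal_lt_of_lt_ofReal (by simpa using hc_lt), fun N hN => ?_⟩
  let farPorts := Finset.Icc (N / 2 + 1) N
  have hcard : farPorts.card = N - N / 2 := by simp [farPorts]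
  have hfar := hc farPorts (by simp [farPorts])
    (fun n => scatterScale κ * √(1 - portCorrelation W lam N n ^ 2))
    (fun n t => scatterScale κ * portCorrelation W lam N n * t + losAmplitude κ)
    (fun n hn => mul_le_mul_of_nonneg_left
      (hs₀_le N n (by grind) (by grind) (by grind)) hσ.le)
    (fun n => by fun_prop)
  rw [← hcard, ← ENNReal.toReal_pow]
  refine ENNReal.toReal_mono (ENNReal.pow_ne_top hc_lt.ne_top) (le_trans (measure_mono ?_) hfar)
  intro ω hω n hn
  rw [← channel_re (by grind)]
  calc |(channel x y W lam κ N n ω).re| ≤ ‖channel x y W lam κ N n ω‖ := Complex.abs_re_le_norm _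
    _ ≤ fasGain x y W lam κ N ω := norm_channel_le_fasGain (by grind)
    _ < √γ := fasGain_lt_sqrt_of_outage hκ hω

lemma exists_outageProb_le_exp_neg {μ : Measure ℝ} [μ.IsOpenPosMeasure]
    (hx : ∀ n, HasLaw (x n) μ P) (hindep : iIndepFun x P) (y : ℕ → Ω → ℝ) (hW : W ≠ 0)
    (hlam : lam ≠ 0) (hκ : 0 ≤ κ) (γ : ℝ) :
    ∃ a : ℝ, 0 < a ∧ ∀ᶠ N : ℕ in atTop, outageProb P x y W lam κ γ N ≤ Real.exp (-(a * N)) := by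
  obtain ⟨c, hc_pos, hc_lt, hc⟩ := exists_outageProb_le_pow hx hindep y hW hlam hκ γ
  have hlog : Real.log c < 0 := Real.log_neg hc_pos hc_lt
  refine ⟨-Real.log c / 2, by linarith, ?_⟩
  filter_upwards [eventually_ge_atTop 2] with N hN
  have hhalf : (N : ℝ) ≤ 2 * (N - N / 2 : ℕ) := by exact_mod_cast (by lia : N ≤ 2 * (N - N / 2))
  calc outageProb P x y W lam κ γ N ≤ c ^ (N - N / 2) := hc N hN
    _ = Real.exp ((N - N / 2 : ℕ) * Real.log c) := by rw [Real.exp_nat_mul, Real.exp_log hc_pos]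
    _ ≤ Real.exp (-(-Real.log c / 2 * N)) := Real.exp_le_exp.2 (by nlinarith)

end Outage

lemma tendsto_id_div_log_atTop : Tendsto (fun t : ℝ => t / Real.log t) atTop atTop := by
  have hzero : Tendsto (fun t : ℝ => Real.log t / t) atTop (𝓝[>] 0) :=
    tendsto_nhdsWithin_iff.2 ⟨Real.isLittleO_log_id_atTop.tendsto_div_nhds_zero, by
      filter_upwards [eventually_gt_atTop 1] with t ht
      exact div_pos (Real.log_pos ht) (by linarith)⟩
  simpa [Pi.inv_def] using hzero.inv_tendsto_nhdsGT_zero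

section ExponentialDecay

variable {p : ℕ → ℝ} {a : ℝ}

lemma tendsto_neg_log_div_log_of_le_exp_neg (ha : 0 < a) (hp : ∀ᶠ N in atTop, 0 < p N)
    (hpa : ∀ᶠ N : ℕ in atTop, p N ≤ Real.exp (-(a * N))) :
    Tendsto (fun N : ℕ => -(Real.log (p N) / Real.log N)) atTop atTop := by
  refine tendsto_atTop_mono' _ ?_
    ((tendsto_id_div_log_atTop.comp tendsto_natCast_atTop_atTop).const_mul_atTop ha)
  filter_upwards [hp, hpa, eventually_ge_atTop 1] with N hpos hle hN
  have hlogp : Real.log (p N) ≤ -(a * N) := (Real.log_le_iff_le_exp hpos).2 hle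
  have hlogN : 0 ≤ Real.log N := Real.log_nonneg (by exact_mod_cast hN)
  calc a * (N / Real.log N) = a * N / Real.log N := (mul_div_assoc _ _ _).symm
    _ ≤ -Real.log (p N) / Real.log N := div_le_div_of_nonneg_right (le_neg.1 hlogp) hlogN
    _ = -(Real.log (p N) / Real.log N) := neg_div _ _

lemma eventually_lt_of_le_exp_neg (ha : 0 < a)
    (hpa : ∀ᶠ N : ℕ in atTop, p N ≤ Real.exp (-(a * N))) {ε : ℝ} (hε : 0 < ε) :
    ∀ᶠ N in atTop, p N < ε := by
  have hexp : Tendsto (fun N : ℕ => Real.exp (-(a * N))) atTop (𝓝 0) :=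
    Real.tendsto_exp_neg_atTop_nhds_zero.comp (tendsto_natCast_atTop_atTop.const_mul_atTop ha)
  filter_upwards [hpa, hexp.eventually_lt_const hε] with N hle hlt using hle.trans_lt hlt

end ExponentialDecay

theorem mainTheorem7_general {Ω : Type*} [MeasurableSpace Ω] (P : Measure Ω) (x y : ℕ → Ω → ℝ)
    (μ : Measure ℝ) [μ.IsOpenPosMeasure] (ν : ℕ → Measure ℝ) [∀ n, (ν n).IsOpenPosMeasure]
    (hx : ∀ n, HasLaw (x n) μ P) (hy : ∀ n, HasLaw (y n) (ν n) P)
    (hindep : iIndepFun (Sum.elim x y) P)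
    (W lam κ γ : ℝ) (hW : W ≠ 0) (hlam : lam ≠ 0) (hκ : 0 ≤ κ) (hγ : 0 < γ) :
    (∀ N n : ℕ, 2 ≤ n → n ≤ N → |portCorrelation W lam N n| ≠ 1) ∧
    (∀ N : ℕ, 1 ≤ N → 0 < outageProb P x y W lam κ γ N) ∧
    Tendsto (fun N : ℕ => -(Real.log (outageProb P x y W lam κ γ N) / Real.log (N : ℝ)))
      atTop atTop ∧
    (∀ ε : ℝ, 0 < ε → ∃ N₀ : ℕ, ∀ N : ℕ, N₀ ≤ N → outageProb P x y W lam κ γ N < ε) := by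
  have hpos := outageProb_pos (fun n => (hx n).aemeasurable) (fun n => (hy n).aemeasurable)
    (fun n => (hx n).map_eq ▸ inferInstance) (fun n => (hy n).map_eq ▸ inferInstance)
    hindep hW hlam hκ hγ
  have hindep_x : iIndepFun x P := hindep.precomp (g := Sum.inl) Sum.inl_injective
  obtain ⟨a, ha, hdecay⟩ := exists_outageProb_le_exp_neg hx hindep_x y hW hlam hκ γ
  exact ⟨fun N n hn hnN => (abs_portCorrelation_lt_one hW hlam hn hnN).ne, fun N _ => hpos N,
    tendsto_neg_log_div_log_of_le_exp_neg ha (.of_forall hpos) hdecay,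
    fun ε hε => eventually_atTop.1 (eventually_lt_of_le_exp_neg ha hdecay hε)⟩

/-- `x n, y n` are independent real Gaussians of mean `0` and variance `1/2`; the antenna has normalized
length `W`, the wavelength is `lam`, the Rician factor is `κ`, and the outage threshold is `γ`. -/
theorem mainTheorem7 {Ω : Type*} [MeasurableSpace Ω] (P : Measure Ω) [IsProbabilityMeasure P]
    (x y : ℕ → Ω → ℝ)
    (hx : ∀ n, HasLaw (x n) (gaussianReal 0 (1 / 2)) P)
    (hy : ∀ n, HasLaw (y n) (gaussianReal 0 (1 / 2)) P)
    (hindep : iIndepFun (Sum.elim x y) P)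
    (W lam κ γ : ℝ) (hW : 0 < W) (hlam : 0 < lam) (hκ : 0 ≤ κ) (hγ : 0 < γ) :
    (∀ N n : ℕ, 2 ≤ n → n ≤ N → |portCorrelation W lam N n| ≠ 1) ∧
    (∀ N : ℕ, 1 ≤ N → 0 < outageProb P x y W lam κ γ N) ∧
    Tendsto (fun N : ℕ => -(Real.log (outageProb P x y W lam κ γ N) / Real.log (N : ℝ)))
      atTop atTop ∧
    (∀ ε : ℝ, 0 < ε → ∃ N₀ : ℕ, ∀ N : ℕ, N₀ ≤ N → outageProb P x y W lam κ γ N < ε) :=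
  have := isOpenPosMeasure_gaussianReal 0 (v := 1 / 2) (by simp)
  mainTheorem7_general P x y _ _ hx hy hindep W lam κ γ hW.ne' hlam.ne' hκ hγ
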